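/- Let $\mathcal A$ be a finite set of base arms and let $\mathcal I$ be a non-empty family of subsets of $\mathcal A$ (the feasible super-arms; e.g. the edge sets of the paths between two given vertices of a graph with edge set $\mathcal A$). Let the true mean rewards $\theta^*_i\sim\mathcal N(\mu_{i},\varsigma_{i}^2)$, $i\in\mathcal A$, be independent, with $\varsigma_{i}>0$, and given $\theta^*$ let the rewards $r_t(i)\sim\mathcal N(\theta^*_i,\sigma_i^2)$, $t\ge 0$, $i\in\mathcal A$, be independent, with known variances $0<\sigma_i^2\le 1$. Write $\mathcal N^R(m,\sigma^2)$ for the rectified Gaussian distribution, i.e. the law of $\max(0,X)$ with $X\sim\mathcal N(m,\sigma^2)$, and let $$f^R_\theta(\boldsymbol a)=-\sum_{i\in\boldsymbol a}\mathbb E_{z\sim\mathcal N^R(-\theta_i,\sigma_i^2)}[z]$$ be the expected reward of a super-arm $\boldsymbol a$ for the mean vector $\theta$. Let $T=BK$, with $B\ge1$ batches of size $K\ge 1$, and assume $T\ge|\mathcal A|$. Consider batched Thompson Sampling with rectified Gaussian costs. Before the first time step every base arm $i$ is played once and its reward $r_0(i)$ is used to update the prior of $\theta^*_i$. In each time step $t$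 of batch $b=1,\dots,B$ (that is, $(b-1)K<t\le bK$) the algorithm draws, independently for all $i$ and $t$ given the past, $\tilde\theta_i$ from the Gaussian posterior of $\theta^*_i$ given the rewards observed initially and in the batches $1,\dots,b-1$, sets $w_{i}=\mathbb E[z_i]$ where $z_i\sim\mathcal N^R(-\tilde\theta_i,\sigma_i^2)$, and plays a super-arm $\boldsymbol a_t\in\arg\min_{\boldsymbol a\in\mathcal I}\sum_{i\in\boldsymbol a}w_{i}$ (with a fixed measurable tie-breaking rule). At the end of batch $b$ the (unrectified) rewards $r_t(i)$, $i\in\boldsymbol a_t$, of all time steps $t$ of the batch are observed, and the posterior parameters are updated by Gaussian conjugacy. Then the regret $\sum_{t=1}^T\big(\max_{\boldsymbol a\in\mathcal I}f^R_{\theta^*}(\boldsymbol a)-f^R_{\theta^*}(\boldsymbol a_t)\big)$ is integrable, and its expectation satisfies $$\mathrm{BayesRegret}(T)=\tilde{\mathcal O}\big(|\mathcal A|K+|\mathcal A|\sqrt T\big),$$ that is, there are absolute constants $C$ and $k$ (independent of $\mathcal A$, $\mathcal I$, $K$, $B$, the prior parameters, the noise variances and the tie-breaking) such that $$\mathrm{BayesRegret}(T)\le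 C\,(1+\log T)^k\big(|\mathcal A|K+|\mathcal A|\sqrt T\big).$$ -/

import Mathlib

open MeasureTheory ProbabilityTheory
open scoped NNReal

namespace BatchedTS

/-- The rectified Gaussian distribution with location `m` and scale parameter `v`: the law of
`max (0, X)` for `X ∼ N(m, v)` (`v` is the variance of `X`). -/
noncomputable def rectifiedGaussian (m : ℝ) (v : ℝ≥0) : Measure ℝ :=
  (gaussianReal m v).map (fun x => max 0 x)

/-- The expected value of the rectified Gaussian distribution. -/
noncomputable def rectMean (m : ℝ) (v : ℝ≥0) : ℝ :=
  ∫ z, z ∂(rectifiedGaussian m v)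

/-- A Gaussian combinatorial semi-bandit problem with base arms `ι`: the feasible super-arms, the
independent Gaussian priors of the mean rewards and the known noise variances. -/
structure SemiBandit (ι : Type*) where
  feasible : Finset (Finset ι)
  feasible_nonempty : feasible.Nonempty
  priorMean : ι → ℝ
  priorVar : ι → ℝ≥0
  priorVar_pos : ∀ i, 0 < priorVar i
  noiseVar : ι → ℝ≥0
  noiseVar_pos : ∀ i, 0 < noiseVar i

/-- A (measurable) solver of the deterministic problem: for every non-negative cost vector it
returns a feasible super-arm of minimal total cost. Ties are broken in an arbitrary way. -/
structure MinOracle {ι : Type*} (feasible : Finset (Finset ι)) where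
  solve : (ι → ℝ) → Finset ι
  solve_mem : ∀ w, (∀ i, 0 ≤ w i) → solve w ∈ feasible
  solve_le : ∀ w, (∀ i, 0 ≤ w i) → ∀ a ∈ feasible, ∑ i ∈ solve w, w i ≤ ∑ i ∈ a, w i
  measurableSet_solve : ∀ a, MeasurableSet {w | solve w = a}

/-- The independent sources of randomness: the true mean reward of each base arm, the
reward noise of base arm `i` at time `t` (time `0` is the initial play), and the internal
randomness that the algorithm uses at time `t` to sample a mean reward for `i`. -/
inductive Source (ι : Type*) where
  | mean (i : ι)
  | noise (t : ℕ) (i : ι)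
  | sampling (t : ℕ) (i : ι)

/-- Parameters (means and variances) of independent Gaussian beliefs about all base arms. -/
structure Params (ι : Type*) where
  mean : ι → ℝ
  var : ι → ℝ≥0

variable {ι : Type*}

/-- The distribution of each source of randomness. -/
noncomputable def SemiBandit.sourceLaw (M : SemiBandit ι) : Source ι → Measure ℝ
  | .mean i => gaussianReal (M.priorMean i) (M.priorVar i)
  | .noise _ i => gaussianReal 0 (M.noiseVar i)
  | .sampling _ _ => gaussianReal 0 1

instance (M : SemiBandit ι) (s : Source ι) : IsProbabilityMeasure (M.sourceLaw s) := by
  cases s <;> (simp only [SemiBandit.sourceLaw]; infer_instance)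

/-- The probability measure of the whole experiment: all sources are independent. -/
noncomputable def SemiBandit.law (M : SemiBandit ι) : Measure (Source ι → ℝ) :=
  Measure.infinitePi M.sourceLaw

/-- The true mean reward vector. -/
def thetaStar (ω : Source ι → ℝ) (i : ι) : ℝ := ω (.mean i)

/-- The reward of base arm `i` at time `t`: given the true means, it is `N(θ*_i, σ_i²)`. -/
def reward (ω : Source ι → ℝ) (t : ℕ) (i : ι) : ℝ := thetaStar ω i + ω (.noise t i)

/-- A draw, made at time `t`, of a mean reward vector from the beliefs `p`. -/
noncomputable def Params.draw (p : Params ι) (ω : Source ι → ℝ) (t : ℕ) (i : ι) : ℝ :=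
  p.mean i + Real.sqrt (p.var i) * ω (.sampling t i)

/-- For fixed beliefs `p`, the draw for base arm `i` has law `N(p.mean i, p.var i)`. -/
theorem map_draw (M : SemiBandit ι) (p : Params ι) (t : ℕ) (i : ι) :
    M.law.map (fun ω => p.draw ω t i) = gaussianReal (p.mean i) (p.var i) := by
  have h1 : M.law.map (fun ω => ω (.sampling t i)) = gaussianReal 0 1 :=
    Measure.infinitePi_map_eval M.sourceLaw (.sampling t i)
  have h2 : (fun ω : Source ι → ℝ => p.draw ω t i)
      = (fun x => p.mean i + x) ∘ (fun x => Real.sqrt (p.var i) * x)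
        ∘ (fun ω => ω (.sampling t i)) := rfl
  rw [h2, ← Measure.map_map (by fun_prop) (by fun_prop),
    ← Measure.map_map (by fun_prop) (by fun_prop), h1, gaussianReal_map_const_mul,
    gaussianReal_map_const_add]
  congr 1
  · simp
  · ext; simp

/-- The edge costs computed from a mean reward vector `θ`: the rectified Gaussian
means `E[z_i]`, `z_i ∼ N^R(-θ_i, σ_i²)`. -/
noncomputable def SemiBandit.cost (M : SemiBandit ι) (θ : ι → ℝ) (i : ι) : ℝ :=
  rectMean (-θ i) (M.noiseVar i)

/-- The expected reward of the super-arm `a`, given the mean vector `θ`, under rectified Gaussian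
base arm rewards. -/
noncomputable def SemiBandit.meanReward (M : SemiBandit ι) (θ : ι → ℝ) (a : Finset ι) : ℝ :=
  -∑ i ∈ a, M.cost θ i

/-- The conjugate Gaussian update of the beliefs about the base arms in `a` after observing
their rewards `r`. -/
noncomputable def SemiBandit.update [DecidableEq ι] (M : SemiBandit ι) (a : Finset ι) (r : ι → ℝ)
    (p : Params ι) : Params ι where
  mean i :=
    if i ∈ a then
      (((p.var i)⁻¹ + (M.noiseVar i)⁻¹)⁻¹ : ℝ≥0) * (p.mean i / p.var i + r i / M.noiseVar i)
    else p.mean i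
  var i := if i ∈ a then ((p.var i)⁻¹ + (M.noiseVar i)⁻¹)⁻¹ else p.var i

/-- The super-arm selected at time `t` by Thompson Sampling with rectified Gaussian costs, on the
basis of the beliefs `p`. -/
noncomputable def SemiBandit.select (M : SemiBandit ι) (O : MinOracle M.feasible) (p : Params ι)
    (ω : Source ι → ℝ) (t : ℕ) : Finset ι :=
  O.solve (M.cost (p.draw ω t))

/-- The beliefs obtained from `p` by processing the rewards of the first `n` time steps after time
`t₀`, where all super-arms in these steps were selected on the basis of `p`. -/
noncomputable def SemiBandit.absorb [DecidableEq ι] (M : SemiBandit ι) (O : MinOracle M.feasible)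
    (p : Params ι) (ω : Source ι → ℝ) (t₀ : ℕ) : ℕ → Params ι
  | 0 => p
  | n + 1 => M.update (M.select O p ω (t₀ + n + 1)) (reward ω (t₀ + n + 1))
      (M.absorb O p ω t₀ n)

/-- The posterior parameters after batch `b`, for batches of size `K`. For `b = 0` these are the
parameters after the initial play, in which every base arm is observed once. -/
noncomputable def SemiBandit.posterior [Fintype ι] [DecidableEq ι] (M : SemiBandit ι)
    (O : MinOracle M.feasible) (K : ℕ) (ω : Source ι → ℝ) : ℕ → Params ι
  | 0 => M.update Finset.univ (reward ω 0) ⟨M.priorMean, M.priorVar⟩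
  | b + 1 => M.absorb O (M.posterior O K ω b) ω (b * K) K

/-- The super-arm played at time `t ≥ 1`. Batch `b + 1` consists of the times
`b * K + 1, …, (b + 1) * K`; in it, the parameters computed after batch `b` are used. -/
noncomputable def SemiBandit.superArm [Fintype ι] [DecidableEq ι] (M : SemiBandit ι)
    (O : MinOracle M.feasible) (K : ℕ) (ω : Source ι → ℝ) (t : ℕ) : Finset ι :=
  M.select O (M.posterior O K ω ((t - 1) / K)) ω t

/-- The cumulative regret over the time steps `1, …, T`. -/
noncomputable def SemiBandit.regret [Fintype ι] [DecidableEq ι] (M : SemiBandit ι)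
    (O : MinOracle M.feasible) (K T : ℕ) (ω : Source ι → ℝ) : ℝ :=
  ∑ t ∈ Finset.Icc 1 T,
    (M.feasible.sup' M.feasible_nonempty (M.meanReward (thetaStar ω))
      - M.meanReward (thetaStar ω) (M.superArm O K ω t))

/-- The Bayesian regret: the expected regret, over the prior, the rewards and the algorithm. -/
noncomputable def SemiBandit.bayesRegret [Fintype ι] [DecidableEq ι] (M : SemiBandit ι)
    (O : MinOracle M.feasible) (K T : ℕ) : ℝ :=
  ∫ ω, M.regret O K T ω ∂M.law

end BatchedTS

/-! The argument is posterior sampling with Gaussian conjugacy. At the start of a batch the beliefs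
are the conditional law of the true means, so a draw made in the batch has the same law as θ*,
jointly with the beliefs (`Tracks.identDistrib`). Hence the optimal values at θ* and at the draw
have equal expectation. As the played super-arm a_t is optimal for the draw, the expected regret of
a step is the expected difference of the values of the same a_t at the draw and at θ*.

The rectified mean is 1-Lipschitz, so this difference is at most the sum of |draw_i - θ*_i| over i ∈
a_t. Both terms lie within L posterior standard deviations of the posterior mean, up to excesses of
expectation at most 4 exp(-L) each (`Tracks.step_regret_le`). With L = log T the excesses cost 8|A|
in total.

The widths are summed pathwise. The initial play and σ_i² ≤ 1 make the posterior precision at least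
1 + N, with N the number of plays in finished batches, whatever the prior. For each arm the sum over
batches of n / √(1 + N), where n ≤ K counts the plays in the batch, is O(√T + K log T): a batch that
more than doubles 1 + N costs at most K and raises log(1 + N) by a constant; the others behave as
without delay (`div_sqrt_le_potential`). -/

namespace BatchedTS

variable {ι : Type*}

/-! ### Resampling coordinates of an infinite product -/

section ProductMeasures

theorem measurable_extend {S κ : Type*} {f : κ → S} (hf : Function.Injective f) :
    Measurable (fun x : (S → ℝ) × (κ → ℝ) => Function.extend f x.2 x.1) := by
  refine measurable_pi_lambda _ fun s => ?_
  by_cases h : ∃ i, f i = s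
  · obtain ⟨i, rfl⟩ := h
    simp only [hf.extend_apply]
    fun_prop
  · simp only [Function.extend_apply' _ _ _ h]
    fun_prop

/-- Resampling finitely many coordinates of an infinite product measure preserves it. -/
theorem infinitePi_map_extend {S κ : Type*} [Fintype κ] (P : S → Measure ℝ)
    [∀ s, IsProbabilityMeasure (P s)] {f : κ → S} (hf : Function.Injective f) :
    ((Measure.infinitePi P).prod (Measure.pi fun i => P (f i))).map
      (fun x : (S → ℝ) × (κ → ℝ) => Function.extend f x.2 x.1) = Measure.infinitePi P := by
  classical
  have hmeas := measurable_extend hf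
  refine Measure.eq_infinitePi P fun s t ht => ?_
  rw [Measure.map_apply hmeas (MeasurableSet.pi s.countable_toSet fun i _ => ht i)]
  -- The preimage of a box is a product of two boxes: untouched coordinates constrain ω, resampled
  -- ones constrain x.
  have hpre : (fun x : (S → ℝ) × (κ → ℝ) => Function.extend f x.2 x.1) ⁻¹' (Set.pi s t) =
      (Set.pi (s.filter fun j => ¬ ∃ i, f i = j) t) ×ˢ
        (Set.pi Set.univ fun i => if f i ∈ s then t (f i) else Set.univ) := by
    ext ⟨ω, x⟩
    simp only [Set.mem_preimage, Set.mem_pi, Finset.mem_coe, Set.mem_prod, Finset.mem_filter,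
      Set.mem_univ, true_imp_iff]
    constructor
    · intro h
      refine ⟨fun j hj => ?_, fun i => ?_⟩
      · simpa only [Function.extend_apply' _ _ _ hj.2] using h j hj.1
      · split_ifs with hi
        · simpa only [hf.extend_apply] using h (f i) hi
        · trivial
    · rintro ⟨h1, h2⟩ j hj
      by_cases h : ∃ i, f i = j
      · obtain ⟨i, rfl⟩ := h
        have := h2 i
        rw [if_pos hj] at this
        simpa only [hf.extend_apply] using this
      · simpa only [Function.extend_apply' _ _ _ h] using h1 j ⟨hj, h⟩
  rw [hpre, Measure.prod_prod, Measure.infinitePi_pi _ (fun i _ => ht i), Measure.pi_pi,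
    ← Finset.prod_filter_mul_prod_filter_not s (fun j => ∃ i, f i = j), mul_comm]
  congr 1
  have h1 : s.filter (fun j => ∃ i, f i = j) = (Finset.univ.filter fun i => f i ∈ s).image f := by
    ext j
    simp only [Finset.mem_filter, Finset.mem_image, Finset.mem_univ, true_and]
    constructor
    · rintro ⟨hj, i, rfl⟩
      exact ⟨i, hj, rfl⟩
    · rintro ⟨i, hi, rfl⟩
      exact ⟨hi, i, rfl⟩
  rw [h1, Finset.prod_image fun _ _ _ _ h => hf h, Finset.prod_filter]
  refine Finset.prod_congr rfl fun i _ => ?_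
  split_ifs <;> simp

/-- Coordinates which a random variable does not depend on are independent of it. -/
theorem lintegral_infinitePi_eq_of_extend {S κ α : Type*} [Fintype κ] [MeasurableSpace α]
    (P : S → Measure ℝ) [∀ s, IsProbabilityMeasure (P s)] {f : κ → S}
    (hf : Function.Injective f) {Y : (S → ℝ) → α} (hY : Measurable Y)
    (hYf : ∀ ω x, Y (Function.extend f x ω) = Y ω) {F : α × (κ → ℝ) → ENNReal}
    (hF : Measurable F) :
    ∫⁻ ω, F (Y ω, fun i => ω (f i)) ∂Measure.infinitePi P =
      ∫⁻ ω, ∫⁻ x, F (Y ω, x) ∂(Measure.pi fun i => P (f i)) ∂Measure.infinitePi P := by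
  have hmeas := measurable_extend hf
  conv_lhs => rw [← infinitePi_map_extend P hf]
  rw [lintegral_map (by fun_prop) hmeas, lintegral_prod _ (by fun_prop)]
  simp only [hYf, hf.extend_apply]

end ProductMeasures

/-! ### One-dimensional Gaussian conjugacy -/

section Conjugacy

theorem prod_gaussianReal_map_affine (c α β : ℝ) (v w : ℝ≥0) :
    ((gaussianReal 0 v).prod (gaussianReal 0 w)).map (fun x => c + (α * x.1 + β * x.2)) =
      gaussianReal c (NNReal.mk (α ^ 2) (sq_nonneg _) * v + NNReal.mk (β ^ 2) (sq_nonneg _) * w) := by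
  have h1 : ((gaussianReal 0 v).prod (gaussianReal 0 w)).map (fun x => α * x.1) =
      gaussianReal 0 (NNReal.mk (α ^ 2) (sq_nonneg _) * v) := by
    have : (fun x : ℝ × ℝ => α * x.1) = (fun y => α * y) ∘ Prod.fst := rfl
    rw [this, ← Measure.map_map (by fun_prop) (by fun_prop), Measure.map_fst_prod]
    simp [gaussianReal_map_const_mul]
  have h2 : ((gaussianReal 0 v).prod (gaussianReal 0 w)).map (fun x => β * x.2) =
      gaussianReal 0 (NNReal.mk (β ^ 2) (sq_nonneg _) * w) := by
    have : (fun x : ℝ × ℝ => β * x.2) = (fun y => β * y) ∘ Prod.snd := rfl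
    rw [this, ← Measure.map_map (by fun_prop) (by fun_prop), Measure.map_snd_prod]
    simp [gaussianReal_map_const_mul]
  have hind : IndepFun (fun x : ℝ × ℝ => α * x.1) (fun x : ℝ × ℝ => β * x.2)
      ((gaussianReal 0 v).prod (gaussianReal 0 w)) :=
    indepFun_prod (X := fun x => α * x) (Y := fun x => β * x) (by fun_prop) (by fun_prop)
  have h3 := gaussianReal_add_gaussianReal_of_indepFun hind h1 h2
  have : (fun x : ℝ × ℝ => c + (α * x.1 + β * x.2)) =
      (fun y => c + y) ∘ ((fun x : ℝ × ℝ => α * x.1) + fun x : ℝ × ℝ => β * x.2) := rfl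
  rw [this, ← Measure.map_map (by fun_prop) (by fun_prop), h3, gaussianReal_map_const_add]
  simp

/-- Conjugacy of the Gaussian distribution: if `θ = m + s z` is observed with noise `e`, then,
given the posterior mean, `θ` is again Gaussian around it, with standard deviation `s'`. -/
theorem gaussian_conjugacy {m s c g s' : ℝ} {w : ℝ≥0} (h0 : c = m * (1 - g))
    (h1 : s ^ 2 = g ^ 2 * (s ^ 2 + w) + s' ^ 2) (h2 : g * s ^ 2 = g ^ 2 * (s ^ 2 + w)) :
    ((gaussianReal 0 1).prod (gaussianReal 0 w)).map
      (fun x => (m + s * x.1, c + g * (m + s * x.1 + x.2))) =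
    (((gaussianReal 0 1).prod (gaussianReal 0 w)).prod (gaussianReal 0 1)).map
      (fun x => (c + g * (m + s * x.1.1 + x.1.2) + s' * x.2,
        c + g * (m + s * x.1.1 + x.1.2))) := by
  have : IsProbabilityMeasure (((gaussianReal 0 1).prod (gaussianReal 0 w)).map
      (fun x => (m + s * x.1, c + g * (m + s * x.1 + x.2)))) :=
    Measure.isProbabilityMeasure_map (by fun_prop)
  have : IsProbabilityMeasure ((((gaussianReal 0 1).prod (gaussianReal 0 w)).prod
      (gaussianReal 0 1)).map (fun x => (c + g * (m + s * x.1.1 + x.1.2) + s' * x.2,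
        c + g * (m + s * x.1.1 + x.1.2)))) :=
    Measure.isProbabilityMeasure_map (by fun_prop)
  -- Cramér–Wold: every linear functional of either pair is a real Gaussian, so it suffices to
  -- compare means and variances.
  refine Measure.ext_of_charFunDual (funext fun L => ?_)
  rw [charFunDual_eq_charFun_map_one, charFunDual_eq_charFun_map_one]
  congr 1
  obtain ⟨A, B, hL⟩ : ∃ A B : ℝ, ∀ x y, L (x, y) = A * x + B * y := by
    refine ⟨L (1, 0), L (0, 1), fun x y => ?_⟩
    have : (x, y) = x • ((1 : ℝ), (0 : ℝ)) + y • ((0 : ℝ), (1 : ℝ)) := by simp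
    rw [this, map_add, map_smul, map_smul, smul_eq_mul, smul_eq_mul, mul_comm, mul_comm y]
  rw [Measure.map_map (by fun_prop) (by fun_prop), Measure.map_map (by fun_prop) (by fun_prop)]
  have e1 : (⇑L ∘ fun x : ℝ × ℝ => (m + s * x.1, c + g * (m + s * x.1 + x.2))) =
      fun x => (A * m + B * (c + g * m)) + ((A * s + B * g * s) * x.1 + (B * g) * x.2) := by
    funext x
    simp only [Function.comp, hL]
    ring
  have e2 : (⇑L ∘ fun x : (ℝ × ℝ) × ℝ => (c + g * (m + s * x.1.1 + x.1.2) + s' * x.2,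
        c + g * (m + s * x.1.1 + x.1.2))) =
      (fun x : ℝ × ℝ => (A + B) * (c + g * m) + (1 * x.1 + (A * s') * x.2)) ∘
        Prod.map (fun x : ℝ × ℝ => 0 + (((A + B) * g * s) * x.1 + ((A + B) * g) * x.2)) id := by
    funext x
    simp only [Function.comp, hL, Prod.map, id]
    ring
  rw [e1, e2, prod_gaussianReal_map_affine, ← Measure.map_map (by fun_prop) (by fun_prop),
    ← Measure.map_prod_map _ _ (by fun_prop) (by fun_prop), Measure.map_id,
    prod_gaussianReal_map_affine, prod_gaussianReal_map_affine]
  congr 1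
  · rw [h0]; ring
  · apply NNReal.coe_injective
    push_cast [NNReal.coe_mk]
    -- `h1` matches the variances of θ and of its redraw, `h2` their covariances with the posterior
    -- mean. Both also allow the gain g = 0 of an unobserved arm.
    linear_combination (A ^ 2) * h1 + 2 * A * B * h2

end Conjugacy

/-! ### Measurability of beliefs and updates -/

section Measurability

instance : MeasurableSpace (Params ι) :=
  MeasurableSpace.comap (fun p => (p.mean, p.var)) inferInstance

instance : MeasurableSpace (Finset ι) := ⊤

theorem measurable_params_prod : Measurable (fun p : Params ι => (p.mean, p.var)) :=
  comap_measurable _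

@[fun_prop]
theorem measurable_params_mean (i : ι) : Measurable (fun p : Params ι => p.mean i) :=
  (measurable_pi_apply i).comp (measurable_fst.comp measurable_params_prod)

@[fun_prop]
theorem measurable_params_var (i : ι) : Measurable (fun p : Params ι => p.var i) :=
  (measurable_pi_apply i).comp (measurable_snd.comp measurable_params_prod)

theorem measurable_params {α : Type*} [MeasurableSpace α] {f : α → Params ι}
    (hm : ∀ i, Measurable fun x => (f x).mean i) (hv : ∀ i, Measurable fun x => (f x).var i) :
    Measurable f := by
  rw [measurable_comap_iff]
  exact (measurable_pi_lambda _ hm).prodMk (measurable_pi_lambda _ hv)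

theorem measurableSet_mem {α : Type*} [MeasurableSpace α] {a : α → Finset ι}
    (ha : Measurable a) (i : ι) : MeasurableSet {x | i ∈ a x} :=
  ha (t := {s | i ∈ s}) trivial

/-- The mean reward vector obtained from the beliefs `p` and a standard Gaussian vector `z`. -/
noncomputable def Params.affine (p : Params ι) (z : ι → ℝ) (i : ι) : ℝ :=
  p.mean i + Real.sqrt (p.var i) * z i

theorem Params.draw_eq_affine (p : Params ι) (ω : Source ι → ℝ) (t : ℕ) :
    p.draw ω t = p.affine (fun i => ω (.sampling t i)) := rfl

@[fun_prop]
theorem measurable_affine {α : Type*} [MeasurableSpace α] {p : α → Params ι} {z : α → ι → ℝ}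
    (hp : Measurable p) (hz : Measurable z) : Measurable fun x => (p x).affine (z x) := by
  refine measurable_pi_lambda _ fun i => ?_
  simp only [Params.affine]
  have h1 := (measurable_params_mean i).comp hp
  have h2 := (measurable_params_var i).comp hp
  have h3 := (measurable_pi_apply i).comp hz
  exact h1.add ((Real.continuous_sqrt.measurable.comp h2.coe_nnreal_real).mul h3)

@[fun_prop]
theorem SemiBandit.measurable_update [DecidableEq ι] (M : SemiBandit ι) {α : Type*}
    [MeasurableSpace α] {a : α → Finset ι} {r : α → ι → ℝ} {p : α → Params ι}
    (ha : Measurable a) (hr : Measurable r) (hp : Measurable p) :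
    Measurable fun x => M.update (a x) (r x) (p x) := by
  refine measurable_params (fun i => ?_) fun i => ?_
  · have h1 := (measurable_params_mean i).comp hp
    have h2 := (measurable_params_var i).comp hp
    have h3 := (measurable_pi_apply i).comp hr
    simp only [SemiBandit.update]
    refine Measurable.ite (measurableSet_mem ha i) ?_ h1
    exact ((h2.inv.add_const _).inv.coe_nnreal_real).mul
      ((h1.div h2.coe_nnreal_real).add (h3.div_const _))
  · have h2 := (measurable_params_var i).comp hp
    simp only [SemiBandit.update]
    exact Measurable.ite (measurableSet_mem ha i) (h2.inv.add_const _).inv h2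

end Measurability

/-! ### Conjugacy for the update of all arms -/

section Update

theorem SemiBandit.update_var_pos [DecidableEq ι] (M : SemiBandit ι) (a : Finset ι) (r : ι → ℝ)
    {p : Params ι} (hp : ∀ i, 0 < p.var i) (i : ι) : 0 < (M.update a r p).var i := by
  simp only [SemiBandit.update]
  split_ifs
  · exact inv_pos.2 (add_pos (inv_pos.2 (hp i)) (inv_pos.2 (M.noiseVar_pos i)))
  · exact hp i

/-- The law of a standard Gaussian vector. -/
noncomputable def stdGaussianVec (ι : Type*) [Fintype ι] : Measure (ι → ℝ) :=
  Measure.pi fun _ => gaussianReal 0 1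

/-- The law of the reward noise of one time step. -/
noncomputable def SemiBandit.noiseVec [Fintype ι] (M : SemiBandit ι) : Measure (ι → ℝ) :=
  Measure.pi fun i => gaussianReal 0 (M.noiseVar i)

instance [Fintype ι] : IsProbabilityMeasure (stdGaussianVec ι) := by
  unfold stdGaussianVec; infer_instance

instance [Fintype ι] (M : SemiBandit ι) : IsProbabilityMeasure M.noiseVec := by
  unfold SemiBandit.noiseVec; infer_instance

/-- Gaussian conjugacy for the update of the beliefs about the base arms in `a`. -/
theorem SemiBandit.lintegral_update [Fintype ι] [DecidableEq ι] (M : SemiBandit ι)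
    (a : Finset ι) {p : Params ι} (hp : ∀ i, 0 < p.var i)
    {H : (ι → ℝ) × Params ι → ENNReal} (hH : Measurable H) :
    ∫⁻ z, ∫⁻ e, H (p.affine z, M.update a (p.affine z + e) p) ∂M.noiseVec ∂stdGaussianVec ι =
      ∫⁻ z, ∫⁻ e, ∫⁻ z', H ((M.update a (p.affine z + e) p).affine z',
        M.update a (p.affine z + e) p) ∂stdGaussianVec ι ∂M.noiseVec ∂stdGaussianVec ι := by
  -- The new variances do not depend on the rewards, so 0 is a dummy; only the means are random, and
  -- they are affine in the rewards with gain `g`.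
  set V : ι → ℝ≥0 := (M.update a 0 p).var with hV
  set g : ι → ℝ := fun i => if i ∈ a then (p.var i : ℝ) / (p.var i + M.noiseVar i) else 0 with hg
  set c : ι → ℝ := fun i => p.mean i * (1 - g i) with hc
  have hupd : ∀ r, M.update a r p = ⟨fun i => c i + g i * r i, V⟩ := by
    intro r
    simp only [SemiBandit.update, hV, hc, hg, Params.mk.injEq, and_true]
    funext i
    have h1 : (p.var i : ℝ) ≠ 0 := NNReal.coe_ne_zero.2 (hp i).ne'
    have h2 : (M.noiseVar i : ℝ) ≠ 0 := NNReal.coe_ne_zero.2 (M.noiseVar_pos i).ne'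
    have h3 : (p.var i : ℝ) + M.noiseVar i ≠ 0 := by positivity
    split_ifs
    · push_cast
      field_simp
      ring
    · ring
  have hmk : Measurable fun m : ι → ℝ => (⟨m, V⟩ : Params ι) :=
    measurable_params (fun i => measurable_pi_apply i) fun i => measurable_const
  set H' : (ι → ℝ × ℝ) → ENNReal := fun y => H (fun i => (y i).1, ⟨fun i => (y i).2, V⟩) with hH'
  have hH'm : Measurable H' := by
    refine hH.comp (Measurable.prodMk (by fun_prop) (hmk.comp (by fun_prop)))
  set f : ι → ℝ × ℝ → ℝ × ℝ := fun i x => (p.mean i + Real.sqrt (p.var i) * x.1,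
    c i + g i * (p.mean i + Real.sqrt (p.var i) * x.1 + x.2)) with hf
  set f' : ι → (ℝ × ℝ) × ℝ → ℝ × ℝ := fun i x =>
    (c i + g i * (p.mean i + Real.sqrt (p.var i) * x.1.1 + x.1.2) + Real.sqrt (V i) * x.2,
    c i + g i * (p.mean i + Real.sqrt (p.var i) * x.1.1 + x.1.2)) with hf'
  have hfm : ∀ i, Measurable (f i) := fun i => by simp only [hf]; fun_prop
  have hfm' : ∀ i, Measurable (f' i) := fun i => by simp only [hf']; fun_prop
  -- Grouping the randomness by arm turns both sides into products, so the identity reduces to one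
  -- arm.
  have key : (Measure.pi fun i => (gaussianReal 0 1).prod (gaussianReal 0 (M.noiseVar i))).map
      (fun x i => f i (x i)) =
      (Measure.pi fun i => ((gaussianReal 0 1).prod (gaussianReal 0 (M.noiseVar i))).prod
        (gaussianReal 0 1)).map (fun x i => f' i (x i)) := by
    have hpm : ∀ i, IsProbabilityMeasure
        (((gaussianReal 0 1).prod (gaussianReal 0 (M.noiseVar i))).map (f i)) :=
      fun i => Measure.isProbabilityMeasure_map (hfm i).aemeasurable
    have hpm' : ∀ i, IsProbabilityMeasure
        ((((gaussianReal 0 1).prod (gaussianReal 0 (M.noiseVar i))).prod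
          (gaussianReal 0 1)).map (f' i)) :=
      fun i => Measure.isProbabilityMeasure_map (hfm' i).aemeasurable
    rw [Measure.pi_map_pi (fun i => (hfm i).aemeasurable),
      Measure.pi_map_pi (fun i => (hfm' i).aemeasurable)]
    congr 1
    funext i
    have h1 : (p.var i : ℝ) ≠ 0 := NNReal.coe_ne_zero.2 (hp i).ne'
    have h2 : (M.noiseVar i : ℝ) ≠ 0 := NNReal.coe_ne_zero.2 (M.noiseVar_pos i).ne'
    have h3 : (p.var i : ℝ) + M.noiseVar i ≠ 0 := by positivity
    apply gaussian_conjugacy rfl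
    · rw [Real.sq_sqrt (p.var i).coe_nonneg, Real.sq_sqrt (V i).coe_nonneg]
      simp only [hV, hg, SemiBandit.update]
      split_ifs
      · push_cast
        field_simp
        ring
      · simp
    · rw [Real.sq_sqrt (p.var i).coe_nonneg]
      simp only [hg]
      split_ifs
      · field_simp
      · simp
  have e1 := (measurePreserving_arrowProdEquivProdArrow ℝ ℝ ι (fun _ => gaussianReal 0 1)
    (fun i => gaussianReal 0 (M.noiseVar i)))
  have e2 := (measurePreserving_arrowProdEquivProdArrow (ℝ × ℝ) ℝ ι
    (fun i => (gaussianReal 0 1).prod (gaussianReal 0 (M.noiseVar i)))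
    (fun _ => gaussianReal 0 1))
  have hG : Measurable fun x : (ι → ℝ) × (ι → ℝ) =>
      H (p.affine x.1, M.update a (p.affine x.1 + x.2) p) := by fun_prop
  have hG' : Measurable fun x : ((ι → ℝ) × (ι → ℝ)) × (ι → ℝ) =>
      H ((M.update a (p.affine x.1.1 + x.1.2) p).affine x.2,
        M.update a (p.affine x.1.1 + x.1.2) p) := by fun_prop
  calc _ = ∫⁻ x, H (p.affine x.1, M.update a (p.affine x.1 + x.2) p)
          ∂((stdGaussianVec ι).prod M.noiseVec) := by
        rw [lintegral_prod _ hG.aemeasurable]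
    _ = ∫⁻ x, H' (fun i => f i (x i))
          ∂(Measure.pi fun i => (gaussianReal 0 1).prod (gaussianReal 0 (M.noiseVar i))) := by
        unfold stdGaussianVec SemiBandit.noiseVec
        rw [← e1.lintegral_comp hG]
        simp only [hupd]
        rfl
    _ = ∫⁻ x, H' (fun i => f' i (x i)) ∂(Measure.pi fun i =>
          ((gaussianReal 0 1).prod (gaussianReal 0 (M.noiseVar i))).prod (gaussianReal 0 1)) := by
        rw [← lintegral_map hH'm (by fun_prop), key, lintegral_map hH'm (by fun_prop)]
    _ = ∫⁻ y, ∫⁻ z', H ((M.update a (p.affine (fun i => (y i).1) + fun i => (y i).2) p).affine z',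
          M.update a (p.affine (fun i => (y i).1) + fun i => (y i).2) p) ∂stdGaussianVec ι
          ∂(Measure.pi fun i => (gaussianReal 0 1).prod (gaussianReal 0 (M.noiseVar i))) := by
        unfold stdGaussianVec
        rw [← lintegral_prod (fun x : (ι → ℝ × ℝ) × (ι → ℝ) =>
          H ((M.update a (p.affine (fun i => (x.1 i).1) + fun i => (x.1 i).2) p).affine x.2,
          M.update a (p.affine (fun i => (x.1 i).1) + fun i => (x.1 i).2) p))
          (by fun_prop), ← e2.lintegral_comp (by fun_prop)]
        simp only [hupd]
        rfl
    _ = ∫⁻ x, ∫⁻ z', H ((M.update a (p.affine x.1 + x.2) p).affine z',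
        M.update a (p.affine x.1 + x.2) p) ∂stdGaussianVec ι
          ∂((stdGaussianVec ι).prod M.noiseVec) := by
        have := e1.lintegral_comp (f := fun x => ∫⁻ z',
          H ((M.update a (p.affine x.1 + x.2) p).affine z',
          M.update a (p.affine x.1 + x.2) p) ∂stdGaussianVec ι) hG'.lintegral_prod_right'
        exact this
    _ = _ := by
        rw [lintegral_prod _ hG'.lintegral_prod_right'.aemeasurable]

end Update

/-! ### Dependence on the past -/

section Determined

/-- Two outcomes with the same true means and the same randomness before time `n`. -/
def AgreeBefore (n : ℕ) (ω ω' : Source ι → ℝ) : Prop :=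
  (∀ i, ω (.mean i) = ω' (.mean i)) ∧
    ∀ t < n, ∀ i, ω (.noise t i) = ω' (.noise t i) ∧ ω (.sampling t i) = ω' (.sampling t i)

theorem AgreeBefore.mono {m n : ℕ} {ω ω' : Source ι → ℝ} (h : AgreeBefore n ω ω') (hmn : m ≤ n) :
    AgreeBefore m ω ω' :=
  ⟨h.1, fun t ht => h.2 t (ht.trans_le hmn)⟩

/-- `Y` is a function of the true means and the randomness before time `n`. -/
def DeterminedBefore {α : Type*} (n : ℕ) (Y : (Source ι → ℝ) → α) : Prop :=
  ∀ ω ω', AgreeBefore n ω ω' → Y ω = Y ω'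

theorem noise_injective (t : ℕ) : Function.Injective (Source.noise (ι := ι) t) :=
  fun _ _ h => (Source.noise.inj h).2

theorem sampling_injective (t : ℕ) : Function.Injective (Source.sampling (ι := ι) t) :=
  fun _ _ h => (Source.sampling.inj h).2

theorem extend_noise_mean (t : ℕ) (x : ι → ℝ) (ω : Source ι → ℝ) (i : ι) :
    Function.extend (Source.noise t) x ω (.mean i) = ω (.mean i) :=
  Function.extend_apply' _ _ _ (by simp)

theorem extend_noise_sampling (t s : ℕ) (x : ι → ℝ) (ω : Source ι → ℝ) (i : ι) :
    Function.extend (Source.noise t) x ω (.sampling s i) = ω (.sampling s i) :=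
  Function.extend_apply' _ _ _ (by simp)

theorem agreeBefore_extend_noise (t : ℕ) (x : ι → ℝ) (ω : Source ι → ℝ) :
    AgreeBefore t (Function.extend (Source.noise t) x ω) ω := by
  refine ⟨extend_noise_mean t x ω, fun s hs i => ⟨?_, extend_noise_sampling t s x ω i⟩⟩
  exact Function.extend_apply' _ _ _ (by simp [hs.ne'])

theorem agreeBefore_extend_sampling (t : ℕ) (x : ι → ℝ) (ω : Source ι → ℝ) :
    AgreeBefore t (Function.extend (Source.sampling t) x ω) ω :=
  ⟨fun i => Function.extend_apply' _ _ _ (by simp), fun s hs i =>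
    ⟨Function.extend_apply' _ _ _ (by simp), Function.extend_apply' _ _ _ (by simp [hs.ne'])⟩⟩

theorem DeterminedBefore.update [DecidableEq ι] {α : Type*} (M : SemiBandit ι) {t : ℕ} {Y : (Source ι → ℝ) → α} {q : (Source ι → ℝ) → Params ι}
    (hYt : DeterminedBefore t Y) (hqt : DeterminedBefore t q) (sel : α × (ι → ℝ) → Finset ι) :
    DeterminedBefore (t + 1) fun ω =>
      M.update (sel (Y ω, fun i => ω (.sampling t i))) (reward ω t) (q ω) := by
  intro ω ω' h
  have h1 := hYt _ _ (h.mono t.le_succ)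
  have h2 := hqt _ _ (h.mono t.le_succ)
  have h3 : (fun i => ω (.sampling t i)) = fun i => ω' (.sampling t i) :=
    funext fun i => (h.2 t t.lt_succ_self i).2
  have h4 : reward ω t = reward ω' t := funext fun i => by
    simp only [reward, thetaStar, h.1 i, (h.2 t t.lt_succ_self i).1]
  simp only [h1, h2, h3, h4]

end Determined

section Sources

@[fun_prop]
theorem measurable_thetaStar : Measurable (thetaStar : (Source ι → ℝ) → ι → ℝ) :=
  measurable_pi_lambda _ fun _ => measurable_pi_apply _

@[fun_prop]
theorem measurable_reward (t : ℕ) : Measurable (fun ω : Source ι → ℝ => reward ω t) :=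
  measurable_pi_lambda _ fun _ => by unfold reward thetaStar; fun_prop

end Sources

/-! ### Integrating out fresh noise and fresh draws -/

section Independence

variable [Fintype ι] (M : SemiBandit ι) {α : Type*} [MeasurableSpace α]

instance : IsProbabilityMeasure M.law := by
  unfold SemiBandit.law; infer_instance

theorem SemiBandit.lintegral_noise (t : ℕ) {Y : (Source ι → ℝ) → α} (hY : Measurable Y)
    (hYt : ∀ ω x, Y (Function.extend (Source.noise t) x ω) = Y ω)
    {F : α × (ι → ℝ) → ENNReal} (hF : Measurable F) :
    ∫⁻ ω, F (Y ω, fun i => ω (.noise t i)) ∂M.law =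
      ∫⁻ ω, ∫⁻ e, F (Y ω, e) ∂M.noiseVec ∂M.law :=
  lintegral_infinitePi_eq_of_extend M.sourceLaw (noise_injective t) hY hYt hF

theorem SemiBandit.lintegral_sampling {t : ℕ} {Y : (Source ι → ℝ) → α} (hY : Measurable Y)
    (hYt : DeterminedBefore t Y) {F : α × (ι → ℝ) → ENNReal} (hF : Measurable F) :
    ∫⁻ ω, F (Y ω, fun i => ω (.sampling t i)) ∂M.law =
      ∫⁻ ω, ∫⁻ z, F (Y ω, z) ∂stdGaussianVec ι ∂M.law :=
  lintegral_infinitePi_eq_of_extend M.sourceLaw (sampling_injective t) hY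
    (fun ω x => hYt _ _ (agreeBefore_extend_sampling t x ω)) hF

end Independence

/-! ### Beliefs as conditional laws -/

section Calibration

variable [Fintype ι] (M : SemiBandit ι) {α : Type*} [MeasurableSpace α]

/-- The beliefs `q` are the conditional law of the true means given `q` and `Y`. -/
def SemiBandit.Calibrated (Y : (Source ι → ℝ) → α) (q : (Source ι → ℝ) → Params ι) : Prop :=
  ∀ F : (ι → ℝ) × α × Params ι → ENNReal, Measurable F →
    ∫⁻ ω, F (thetaStar ω, Y ω, q ω) ∂M.law =
      ∫⁻ ω, ∫⁻ z, F ((q ω).affine z, Y ω, q ω) ∂stdGaussianVec ι ∂M.law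

variable {M}

/-- The observed set depends only on `Y` and on sampling randomness independent of the true means
and the current beliefs. Conditionally on these it is a fixed set, to which Gaussian conjugacy
applies. Keeping `Y` apart from `q` accounts for the delay: within a batch the selections use the
beliefs at its start, while `q` already absorbs rewards. -/
theorem SemiBandit.Calibrated.update [DecidableEq ι] {t : ℕ} {Y : (Source ι → ℝ) → α}
    {q : (Source ι → ℝ) → Params ι} (h : M.Calibrated Y q) (hY : Measurable Y) (hq : Measurable q)
    (hYt : DeterminedBefore t Y) (hqt : DeterminedBefore t q) (hpos : ∀ ω i, 0 < (q ω).var i)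
    {sel : α × (ι → ℝ) → Finset ι} (hsel : Measurable sel) :
    M.Calibrated Y fun ω =>
      M.update (sel (Y ω, fun i => ω (.sampling t i))) (reward ω t) (q ω) := by
  -- Integrate out the noise, then the sampling, then replace the true means by a draw from `q`.
  -- This is used for `F` and for its average over a redraw from the updated beliefs.
  have key : ∀ F : (ι → ℝ) × α × Params ι → ENNReal, Measurable F →
      ∫⁻ ω, F (thetaStar ω, Y ω,
        M.update (sel (Y ω, fun i => ω (.sampling t i))) (reward ω t) (q ω)) ∂M.law =
      ∫⁻ ω, ∫⁻ ζ, ∫⁻ z, ∫⁻ e, F ((q ω).affine z, Y ω,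
        M.update (sel (Y ω, ζ)) ((q ω).affine z + e) (q ω)) ∂M.noiseVec ∂stdGaussianVec ι
          ∂stdGaussianVec ι ∂M.law := by
    intro F hF
    have hF2 : Measurable fun x : (((ι → ℝ) × α × Params ι) × (ι → ℝ)) × (ι → ℝ) =>
        F (x.1.1.1, x.1.1.2.1, M.update (sel (x.1.1.2.1, x.1.2)) (x.1.1.1 + x.2) x.1.1.2.2) := by
      fun_prop
    have hX : Measurable fun ω => (thetaStar ω, Y ω, q ω) := by fun_prop
    have hF3 := hF2.lintegral_prod_right' (ν := M.noiseVec)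
    have hF4 := hF3.lintegral_prod_right' (ν := stdGaussianVec ι)
    have e1 := M.lintegral_noise t (Y := fun ω =>
      ((thetaStar ω, Y ω, q ω), fun i => ω (.sampling t i))) (by fun_prop) (fun ω x => by
        have h1 := agreeBefore_extend_noise t x ω
        have h2 : thetaStar (Function.extend (Source.noise t) x ω) = thetaStar ω :=
          funext fun i => h1.1 i
        simp only [hYt _ _ h1, hqt _ _ h1, extend_noise_sampling, h2]) hF2
    have e2 := M.lintegral_sampling (t := t) hX (fun ω ω' h1 => by
      have h2 : thetaStar ω = thetaStar ω' := funext fun i => h1.1 i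
      simp only [hYt _ _ h1, hqt _ _ h1, h2]) hF3
    have e3 := h _ hF4
    refine (e1.trans (e2.trans e3)).trans (lintegral_congr fun ω => ?_)
    refine lintegral_lintegral_swap (Measurable.aemeasurable ?_)
    have hg : Measurable fun x : (ι → ℝ) × (ι → ℝ) => (((q ω).affine x.1, Y ω, q ω), x.2) := by
      fun_prop
    exact hF3.comp hg
  intro F hF
  have hF' : Measurable fun x : (ι → ℝ) × α × Params ι =>
      ∫⁻ z', F (x.2.2.affine z', x.2.1, x.2.2) ∂stdGaussianVec ι := by
    refine Measurable.lintegral_prod_right' (f := fun y : ((ι → ℝ) × α × Params ι) × (ι → ℝ) =>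
      F (y.1.2.2.affine y.2, y.1.2.1, y.1.2.2)) ?_
    fun_prop
  rw [key F hF]
  refine Eq.trans ?_ (key _ hF').symm
  refine lintegral_congr fun ω => lintegral_congr fun ζ => ?_
  exact M.lintegral_update (sel (Y ω, ζ)) (hpos ω) (H := fun x => F (x.1, Y ω, x.2))
    (by fun_prop)

theorem SemiBandit.calibrated_prior (M : SemiBandit ι) :
    M.Calibrated (fun _ => ()) fun _ => ⟨M.priorMean, M.priorVar⟩ := by
  intro F hF
  have hm : Function.Injective (Source.mean (ι := ι)) := fun _ _ h => Source.mean.inj h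
  have h1 := lintegral_infinitePi_eq_of_extend M.sourceLaw hm (Y := fun _ => ()) measurable_const
    (fun _ _ => rfl) (F := fun x => F (x.2, (), ⟨M.priorMean, M.priorVar⟩)) (by fun_prop)
  refine h1.trans (lintegral_congr fun ω => ?_)
  have h2 : (stdGaussianVec ι).map (fun z => Params.affine ⟨M.priorMean, M.priorVar⟩ z) =
      Measure.pi fun i => M.sourceLaw (.mean i) := by
    have h3 : ∀ i, (gaussianReal 0 1).map
        (fun x => M.priorMean i + Real.sqrt (M.priorVar i) * x) = M.sourceLaw (.mean i) := by
      intro i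
      have : (fun x => M.priorMean i + Real.sqrt (M.priorVar i) * x) =
        (fun x => M.priorMean i + x) ∘ fun x => Real.sqrt (M.priorVar i) * x := rfl
      rw [this, ← Measure.map_map (by fun_prop) (by fun_prop), gaussianReal_map_const_mul,
        gaussianReal_map_const_add, SemiBandit.sourceLaw]
      congr 1
      · simp
      · ext; simp
    have h4 : ∀ i, IsProbabilityMeasure ((gaussianReal 0 1).map
        (fun x => M.priorMean i + Real.sqrt (M.priorVar i) * x)) := fun i => by
      rw [h3]; infer_instance
    have h5 := Measure.pi_map_pi (μ := fun _ : ι => gaussianReal 0 1)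
      (f := fun i x => M.priorMean i + Real.sqrt (M.priorVar i) * x)
      fun i => Measurable.aemeasurable (by fun_prop)
    simp only [h3] at h5
    exact h5
  rw [← h2, lintegral_map (by fun_prop) (by fun_prop)]

end Calibration

/-! ### The rectified mean is 1-Lipschitz -/

section Cost

theorem rectMean_eq (m : ℝ) (v : ℝ≥0) :
    rectMean m v = ∫ x, max 0 (m + x) ∂gaussianReal 0 v := by
  have h : gaussianReal m v = (gaussianReal 0 v).map fun x => m + x := by
    rw [gaussianReal_map_const_add, zero_add]
  rw [rectMean, rectifiedGaussian, integral_map (by fun_prop) (by fun_prop), h,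
    integral_map (by fun_prop) (by fun_prop)]

theorem integrable_max_gaussianReal (m : ℝ) (v : ℝ≥0) :
    Integrable (fun x => max 0 (m + x)) (gaussianReal 0 v) := by
  have h : Integrable (fun x : ℝ => x) (gaussianReal 0 v) :=
    (memLp_id_gaussianReal 1).integrable le_rfl
  exact (integrable_zero _ _ _).sup ((integrable_const m).add h)

theorem rectMean_nonneg (m : ℝ) (v : ℝ≥0) : 0 ≤ rectMean m v := by
  rw [rectMean_eq]
  exact integral_nonneg fun x => le_max_left _ _

theorem abs_rectMean_sub_le (m m' : ℝ) (v : ℝ≥0) :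
    |rectMean m v - rectMean m' v| ≤ |m - m'| := by
  rw [rectMean_eq, rectMean_eq,
    ← integral_sub (integrable_max_gaussianReal m v) (integrable_max_gaussianReal m' v)]
  refine (abs_integral_le_integral_abs).trans ?_
  refine (integral_mono ((integrable_max_gaussianReal m v).sub
    (integrable_max_gaussianReal m' v)).abs (integrable_const |m - m'|) fun x => ?_).trans
      (by simp)
  refine (abs_max_sub_max_le_max _ _ _ _).trans ?_
  simp

theorem measurable_rectMean (v : ℝ≥0) : Measurable fun m => rectMean m v := by
  have : LipschitzWith 1 fun m => rectMean m v :=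
    LipschitzWith.of_dist_le_mul fun m m' => by
      simpa [Real.dist_eq] using abs_rectMean_sub_le m m' v
  exact this.continuous.measurable

variable (M : SemiBandit ι)

theorem SemiBandit.cost_nonneg (θ : ι → ℝ) (i : ι) : 0 ≤ M.cost θ i :=
  rectMean_nonneg _ _

theorem SemiBandit.abs_cost_sub_le (θ θ' : ι → ℝ) (i : ι) :
    |M.cost θ i - M.cost θ' i| ≤ |θ i - θ' i| := by
  refine (abs_rectMean_sub_le _ _ _).trans_eq ?_
  rw [← abs_neg]
  ring_nf

@[fun_prop]
theorem SemiBandit.measurable_cost : Measurable M.cost :=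
  measurable_pi_lambda _ fun i => (measurable_rectMean _).comp (measurable_pi_apply i).neg

@[fun_prop]
theorem MinOracle.measurable_solve [Finite ι] {feasible : Finset (Finset ι)}
    (O : MinOracle feasible) : Measurable O.solve := by
  intro s _
  have : O.solve ⁻¹' s = ⋃ a ∈ s, {w | O.solve w = a} := by
    ext w; simp
  rw [this]
  exact MeasurableSet.biUnion s.to_countable fun a _ => O.measurableSet_solve a

theorem SemiBandit.measurable_meanReward [Finite ι] {α : Type*} [MeasurableSpace α]
    {θ : α → ι → ℝ} {a : α → Finset ι} (hθ : Measurable θ) (ha : Measurable a) :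
    Measurable fun x => M.meanReward (θ x) (a x) := by
  have := Fintype.ofFinite ι
  classical
  have h : (fun x => M.meanReward (θ x) (a x)) =
      fun x => -∑ i, if i ∈ a x then M.cost (θ x) i else 0 := by
    funext x
    simp [SemiBandit.meanReward]
  rw [h]
  refine (Finset.measurable_sum _ fun i _ => ?_).neg
  exact Measurable.ite (measurableSet_mem ha i)
    ((measurable_pi_apply i).comp (M.measurable_cost.comp hθ)) measurable_const

end Cost

/-! ### The posterior is calibrated; probability matching -/

section Posterior

variable [Fintype ι] [DecidableEq ι] (M : SemiBandit ι) (O : MinOracle M.feasible)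

/-- The super-arm selected by the beliefs `x.1` and the standard Gaussian vector `x.2`. -/
noncomputable def SemiBandit.choice (x : Params ι × (ι → ℝ)) : Finset ι :=
  O.solve (M.cost (x.1.affine x.2))

omit [DecidableEq ι] in
theorem SemiBandit.measurable_choice : Measurable (M.choice O) := by
  unfold SemiBandit.choice; fun_prop

/-- The beliefs `q` are measurable, non-degenerate, calibrated and known before time `n`. -/
structure SemiBandit.Tracks {α : Type*} [MeasurableSpace α] (n : ℕ) (Y : (Source ι → ℝ) → α)
    (q : (Source ι → ℝ) → Params ι) : Prop where
  measurable : Measurable q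
  determined : DeterminedBefore n q
  var_pos : ∀ ω i, 0 < (q ω).var i
  calibrated : M.Calibrated Y q

variable {M}

theorem SemiBandit.Tracks.update {α : Type*} [MeasurableSpace α] {t : ℕ}
    {Y : (Source ι → ℝ) → α} {q : (Source ι → ℝ) → Params ι} (h : M.Tracks t Y q)
    (hY : Measurable Y) (hYt : DeterminedBefore t Y) {sel : α × (ι → ℝ) → Finset ι}
    (hsel : Measurable sel) :
    M.Tracks (t + 1) Y fun ω =>
      M.update (sel (Y ω, fun i => ω (.sampling t i))) (reward ω t) (q ω) where
  measurable := by
    have := h.measurable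
    fun_prop
  determined := hYt.update M h.determined sel
  var_pos ω := M.update_var_pos _ _ (h.var_pos ω)
  calibrated := h.calibrated.update hY h.measurable hYt h.determined h.var_pos hsel

theorem SemiBandit.Tracks.absorb {t₀ : ℕ} {p : (Source ι → ℝ) → Params ι}
    (h : M.Tracks (t₀ + 1) (fun _ => ()) p) (n : ℕ) :
    M.Tracks (t₀ + n + 1) p fun ω => M.absorb O (p ω) ω t₀ n := by
  induction n with
  | zero =>
    -- At the start of a batch `Y` and `q` coincide, so calibration given `q` alone suffices.
    refine ⟨h.measurable, h.determined, h.var_pos, fun F hF => ?_⟩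
    exact h.calibrated (fun x => F (x.1, x.2.2, x.2.2)) (by fun_prop)
  | succ n ih =>
    exact ih.update h.measurable
      (fun ω ω' hω => h.determined _ _ (hω.mono (by omega))) (M.measurable_choice O)

theorem SemiBandit.tracks_posterior (K b : ℕ) :
    M.Tracks (b * K + 1) (fun _ => ()) fun ω => M.posterior O K ω b := by
  induction b with
  | zero =>
    rw [zero_mul]
    have h : M.Tracks 0 (fun _ => ()) fun _ => ⟨M.priorMean, M.priorVar⟩ :=
      ⟨measurable_const, fun _ _ _ => rfl, fun _ => M.priorVar_pos, M.calibrated_prior⟩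
    -- The initial play is an update at time 0 with a constant selection; hence the `+ 1` in the
    -- time bound.
    exact h.update measurable_const (fun _ _ _ => rfl) (sel := fun _ => Finset.univ)
      measurable_const
  | succ b ih =>
    have h := ih.absorb O K
    rw [show b * K + K + 1 = (b + 1) * K + 1 by ring] at h
    exact ⟨h.measurable, h.determined, h.var_pos, fun F hF =>
      h.calibrated (fun x => F (x.1, (), x.2.2)) (by fun_prop)⟩

omit [DecidableEq ι] in
/-- Probability matching: a draw from the beliefs has the same law as the true means, jointly
with the beliefs. -/
theorem SemiBandit.Tracks.identDistrib {n t : ℕ} {q : (Source ι → ℝ) → Params ι}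
    (h : M.Tracks n (fun _ => ()) q) (hnt : n ≤ t) :
    IdentDistrib (fun ω => (thetaStar ω, q ω)) (fun ω => ((q ω).draw ω t, q ω)) M.law M.law := by
  have hq := h.measurable
  have h1 : Measurable fun ω => (thetaStar ω, q ω) := by fun_prop
  have h2 : Measurable fun ω => ((q ω).draw ω t, q ω) := by
    simp only [Params.draw_eq_affine]; fun_prop
  refine ⟨h1.aemeasurable, h2.aemeasurable, Measure.ext_of_lintegral _ fun F hF => ?_⟩
  rw [lintegral_map hF h1, lintegral_map hF h2]
  refine (h.calibrated (fun x => F (x.1, x.2.2)) (by fun_prop)).trans ?_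
  exact (M.lintegral_sampling hq (fun ω ω' hω => h.determined _ _ (hω.mono hnt))
    (F := fun x => F (x.1.affine x.2, x.1)) (by fun_prop)).symm

end Posterior

/-! ### Growth of the posterior precision -/

section Precision

variable [DecidableEq ι] (M : SemiBandit ι) (O : MinOracle M.feasible)

/-- An observation adds 1/σ_i² ≥ 1 to the precision. -/
theorem SemiBandit.inv_var_update_ge (hM : ∀ i, M.noiseVar i ≤ 1) (a : Finset ι) (r : ι → ℝ)
    (p : Params ι) (i : ι) :
    (p.var i)⁻¹ + (if i ∈ a then 1 else 0 : ℕ) ≤ ((M.update a r p).var i)⁻¹ := by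
  simp only [SemiBandit.update]
  split_ifs
  · rw [inv_inv, Nat.cast_one]
    exact add_le_add le_rfl ((one_le_inv₀ (M.noiseVar_pos i)).2 (hM i))
  · simp

theorem SemiBandit.inv_var_absorb_ge (hM : ∀ i, M.noiseVar i ≤ 1) (p : Params ι)
    (ω : Source ι → ℝ) (t₀ n : ℕ) (i : ι) :
    (p.var i)⁻¹ + (∑ j ∈ Finset.range n, if i ∈ M.select O p ω (t₀ + j + 1) then 1 else 0 : ℕ) ≤
      ((M.absorb O p ω t₀ n).var i)⁻¹ := by
  induction n with
  | zero => simp [SemiBandit.absorb]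
  | succ n ih =>
    rw [Finset.sum_range_succ, Nat.cast_add, ← add_assoc]
    exact (add_le_add ih le_rfl).trans (M.inv_var_update_ge hM _ _ _ i)

variable [Fintype ι]

/-- The number of plays of the base arm `i` in batch `b + 1`. -/
noncomputable def SemiBandit.plays (K : ℕ) (ω : Source ι → ℝ) (i : ι) (b : ℕ) : ℕ :=
  ∑ j ∈ Finset.range K, if i ∈ M.superArm O K ω (b * K + j + 1) then 1 else 0

theorem SemiBandit.plays_le (K : ℕ) (ω : Source ι → ℝ) (i : ι) (b : ℕ) :
    M.plays O K ω i b ≤ K := by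
  refine (Finset.sum_le_card_nsmul _ _ 1 fun j _ => ?_).trans (by simp)
  split_ifs <;> simp

theorem SemiBandit.superArm_eq {K j : ℕ} (hj : j < K) (ω : Source ι → ℝ) (b : ℕ) :
    M.superArm O K ω (b * K + j + 1) =
      M.select O (M.posterior O K ω b) ω (b * K + j + 1) := by
  have : (b * K + j + 1 - 1) / K = b := by
    rw [Nat.add_sub_cancel, mul_comm, Nat.mul_add_div (by omega), Nat.div_eq_of_lt hj, add_zero]
  rw [SemiBandit.superArm, this]

/-- The leading 1 comes from the initial play; it frees the bound from the prior variance. -/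
theorem SemiBandit.inv_var_posterior_ge (hM : ∀ i, M.noiseVar i ≤ 1) (K : ℕ) (ω : Source ι → ℝ)
    (b : ℕ) (i : ι) :
    1 + ((∑ b' ∈ Finset.range b, M.plays O K ω i b' : ℕ) : ℝ≥0) ≤
      ((M.posterior O K ω b).var i)⁻¹ := by
  induction b with
  | zero =>
    have := M.inv_var_update_ge hM Finset.univ (reward ω 0) ⟨M.priorMean, M.priorVar⟩ i
    refine le_trans ?_ this
    simp
  | succ b ih =>
    refine le_trans ?_ (M.inv_var_absorb_ge O hM (M.posterior O K ω b) ω (b * K) K i)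
    rw [Finset.sum_range_succ, Nat.cast_add, ← add_assoc]
    refine add_le_add ih (le_of_eq ?_)
    congr 1
    refine Finset.sum_congr rfl fun j hj => ?_
    rw [M.superArm_eq O (Finset.mem_range.1 hj)]

theorem SemiBandit.sqrt_var_posterior_le (hM : ∀ i, M.noiseVar i ≤ 1) (K : ℕ)
    (ω : Source ι → ℝ) (b : ℕ) (i : ι) :
    Real.sqrt ((M.posterior O K ω b).var i) ≤
      1 / Real.sqrt (1 + (∑ b' ∈ Finset.range b, M.plays O K ω i b' : ℕ)) := by
  have h := M.inv_var_posterior_ge O hM K ω b i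
  have hpos := (M.tracks_posterior O K b).var_pos ω i
  rw [le_inv_comm₀ (by positivity) hpos] at h
  have h' : ((M.posterior O K ω b).var i : ℝ) ≤
      (1 + ((∑ b' ∈ Finset.range b, M.plays O K ω i b' : ℕ) : ℝ))⁻¹ := by
    exact_mod_cast h
  rw [one_div, ← Real.sqrt_inv]
  exact Real.sqrt_le_sqrt h'

end Precision

/-! ### The batched pigeonhole sum -/

section Pigeonhole

/-- The right side is the increment of the potential 3√(1 + N) + 2K log(1 + N), so summation over
batches telescopes. -/
theorem div_sqrt_le_potential {n N K : ℝ} (hn : 0 ≤ n) (hN : 0 ≤ N) (hnK : n ≤ K) :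
    n * (1 / Real.sqrt (1 + N)) ≤
      (3 * Real.sqrt (1 + (N + n)) + 2 * K * Real.log (1 + (N + n))) -
        (3 * Real.sqrt (1 + N) + 2 * K * Real.log (1 + N)) := by
  have hs : 1 ≤ Real.sqrt (1 + N) := Real.one_le_sqrt.2 (by linarith)
  have hs2 : Real.sqrt (1 + N) ^ 2 = 1 + N := Real.sq_sqrt (by linarith)
  have hu2 : Real.sqrt (1 + (N + n)) ^ 2 = 1 + (N + n) := Real.sq_sqrt (by linarith)
  have hsu : Real.sqrt (1 + N) ≤ Real.sqrt (1 + (N + n)) := Real.sqrt_le_sqrt (by linarith)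
  have hlog : Real.log (1 + N) ≤ Real.log (1 + (N + n)) :=
    Real.log_le_log (by linarith) (by linarith)
  have hK : 0 ≤ K := hn.trans hnK
  -- If 1 + N at most doubles, the new root is at most twice the old one, so the increment of the
  -- root is at least n / (3√(1 + N)). Otherwise the logarithm gains at least log 2 > 1/2, which
  -- pays for the trivial bound K.
  by_cases h : n ≤ 1 + N
  · have h1 : n * (1 / Real.sqrt (1 + N)) ≤
        3 * (Real.sqrt (1 + (N + n)) - Real.sqrt (1 + N)) := by
      rw [mul_one_div, div_le_iff₀ (by linarith)]
      have h2 : Real.sqrt (1 + (N + n)) ≤ 2 * Real.sqrt (1 + N) := by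
        refine Real.sqrt_le_iff.2 ⟨by linarith, ?_⟩
        nlinarith
      nlinarith
    nlinarith [mul_nonneg hK (sub_nonneg.2 hlog)]
  · push Not at h
    have h1 : n * (1 / Real.sqrt (1 + N)) ≤ K := by
      rw [mul_one_div]
      exact (div_le_self hn hs).trans hnK
    have h2 : 1 / 2 ≤ Real.log (1 + (N + n)) - Real.log (1 + N) := by
      rw [← Real.log_div (by linarith) (by linarith)]
      have h3 : Real.log 2 ≤ Real.log ((1 + (N + n)) / (1 + N)) :=
        Real.log_le_log (by norm_num) (by rw [le_div_iff₀ (by linarith)]; linarith)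
      linarith [Real.log_two_gt_d9]
    nlinarith [mul_le_mul_of_nonneg_left h2 hK]

theorem sum_div_sqrt_le {n : ℕ → ℕ} {K : ℕ} (hn : ∀ b, n b ≤ K) (B : ℕ) :
    ∑ b ∈ Finset.range B, (n b : ℝ) *
        (1 / Real.sqrt (1 + (∑ b' ∈ Finset.range b, n b' : ℕ))) ≤
      3 * Real.sqrt (1 + (B * K : ℕ)) + 2 * K * Real.log (1 + (B * K : ℕ)) := by
  have key : ∑ b ∈ Finset.range B, (n b : ℝ) *
        (1 / Real.sqrt (1 + (∑ b' ∈ Finset.range b, n b' : ℕ))) ≤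
      3 * Real.sqrt (1 + (∑ b' ∈ Finset.range B, n b' : ℕ)) +
        2 * K * Real.log (1 + (∑ b' ∈ Finset.range B, n b' : ℕ)) := by
    induction B with
    | zero => simp
    | succ B ih =>
      rw [Finset.sum_range_succ, Finset.sum_range_succ (fun b' => n b'), Nat.cast_add]
      have := div_sqrt_le_potential (n := n B) (K := K)
        (N := (∑ b' ∈ Finset.range B, n b' : ℕ)) (by positivity) (by positivity)
        (by exact_mod_cast hn B)
      linarith
  have hS : ∑ b' ∈ Finset.range B, n b' ≤ B * K := by
    refine (Finset.sum_le_card_nsmul _ _ K fun b _ => hn b).trans (by simp)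
  have hS' : ((∑ b' ∈ Finset.range B, n b' : ℕ) : ℝ) ≤ (B * K : ℕ) := by exact_mod_cast hS
  refine key.trans ?_
  gcongr

theorem sum_Icc_mul_eq {α : Type*} [AddCommMonoid α] (f : ℕ → α) (B K : ℕ) :
    ∑ t ∈ Finset.Icc 1 (B * K), f t =
      ∑ b ∈ Finset.range B, ∑ j ∈ Finset.range K, f (b * K + j + 1) := by
  have h : ∀ n, ∑ t ∈ Finset.Icc 1 n, f t = ∑ t ∈ Finset.range n, f (t + 1) := by
    intro n
    induction n with
    | zero => simp
    | succ n ih => rw [Finset.sum_Icc_succ_top (by omega), ih, Finset.sum_range_succ]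
  rw [h]
  induction B with
  | zero => simp
  | succ B ih => rw [add_mul, one_mul, Finset.sum_range_add, ih, Finset.sum_range_succ]

end Pigeonhole

/-! ### Optimal values and comparison of mean vectors -/

section Optimum

variable (M : SemiBandit ι) (O : MinOracle M.feasible)

theorem SemiBandit.sup'_meanReward (θ : ι → ℝ) :
    M.feasible.sup' M.feasible_nonempty (M.meanReward θ) =
      M.meanReward θ (O.solve (M.cost θ)) := by
  refine le_antisymm (Finset.sup'_le _ _ fun a ha => ?_)
    (Finset.le_sup' (M.meanReward θ) (O.solve_mem _ (M.cost_nonneg θ)))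
  exact neg_le_neg (O.solve_le _ (M.cost_nonneg θ) a ha)

theorem SemiBandit.abs_meanReward_le [Fintype ι] (θ : ι → ℝ) (a : Finset ι) :
    |M.meanReward θ a| ≤ ∑ i, (|θ i| + M.cost 0 i) := by
  rw [SemiBandit.meanReward, abs_neg, abs_of_nonneg (Finset.sum_nonneg fun i _ =>
    M.cost_nonneg θ i)]
  refine (Finset.sum_le_univ_sum_of_nonneg fun i => M.cost_nonneg θ i).trans ?_
  refine Finset.sum_le_sum fun i _ => ?_
  have h := (le_abs_self _).trans (M.abs_cost_sub_le θ 0 i)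
  simp only [Pi.zero_apply, sub_zero] at h
  linarith

/-- Lipschitz costs and the triangle inequality through the centre `m`. The excesses are kept for
all arms, so that their expectations do not involve the random `a`. -/
theorem SemiBandit.meanReward_sub_le [Fintype ι] [DecidableEq ι] (θ θ' m s : ι → ℝ) (L : ℝ)
    (a : Finset ι) :
    M.meanReward θ a - M.meanReward θ' a ≤
      ∑ i, ((if i ∈ a then 2 * L * s i else 0) +
        (max 0 (|θ' i - m i| - L * s i) + max 0 (|θ i - m i| - L * s i))) := by
  have h1 : M.meanReward θ a - M.meanReward θ' a =
      ∑ i, if i ∈ a then M.cost θ' i - M.cost θ i else 0 := by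
    simp only [SemiBandit.meanReward, Finset.sum_ite_mem, Finset.univ_inter,
      Finset.sum_sub_distrib]
    ring
  rw [h1]
  refine Finset.sum_le_sum fun i _ => ?_
  have h2 := le_max_left 0 (|θ' i - m i| - L * s i)
  have h3 := le_max_left 0 (|θ i - m i| - L * s i)
  have h4 := le_max_right 0 (|θ' i - m i| - L * s i)
  have h5 := le_max_right 0 (|θ i - m i| - L * s i)
  split_ifs
  · have h6 := (le_abs_self _).trans (M.abs_cost_sub_le θ' θ i)
    have h7 : |θ' i - θ i| ≤ |θ' i - m i| + |θ i - m i| := by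
      rw [abs_sub_comm (θ i)]
      exact abs_sub_le _ _ _
    linarith
  · linarith

end Optimum

/-! ### Gaussian tails -/

section Excess

variable (M : SemiBandit ι)

theorem SemiBandit.integrable_thetaStar (i : ι) :
    Integrable (fun ω => thetaStar ω i) M.law := by
  have h := measurePreserving_eval_infinitePi M.sourceLaw (.mean i)
  have h2 : Integrable (fun x : ℝ => x) (M.sourceLaw (.mean i)) :=
    (memLp_id_gaussianReal 1).integrable le_rfl
  exact h.integrable_comp_of_integrable h2

theorem SemiBandit.integral_exp_sampling (t : ℕ) (i : ι) (c : ℝ) :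
    Integrable (fun ω : Source ι → ℝ => Real.exp (c * ω (.sampling t i))) M.law ∧
      ∫ ω, Real.exp (c * ω (.sampling t i)) ∂M.law = Real.exp (c ^ 2 / 2) := by
  have h := measurePreserving_eval_infinitePi M.sourceLaw (.sampling t i)
  have h2 : Integrable (fun x : ℝ => Real.exp (c * x)) (M.sourceLaw (.sampling t i)) :=
    integrable_exp_mul_gaussianReal c
  refine ⟨h.integrable_comp_of_integrable h2, ?_⟩
  have h3 : mgf (fun ω : Source ι → ℝ => ω (.sampling t i)) M.law c = _ :=
    mgf_gaussianReal h.map_eq c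
  rw [mgf] at h3
  rw [h3]
  simp

variable {M}

/-- The deviation of a mean reward from the beliefs rarely exceeds `L` standard deviations. -/
theorem SemiBandit.Tracks.integral_excess_le [Fintype ι] {n : ℕ} {q : (Source ι → ℝ) → Params ι}
    (h : M.Tracks n (fun _ => ()) q) (t : ℕ) (hq : ∀ ω i, (q ω).var i ≤ 1) (i : ι) (L : ℝ) :
    Integrable (fun ω => max 0 (|(q ω).draw ω t i - (q ω).mean i| -
        L * Real.sqrt ((q ω).var i))) M.law ∧
      ∫ ω, max 0 (|(q ω).draw ω t i - (q ω).mean i| - L * Real.sqrt ((q ω).var i)) ∂M.law ≤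
        4 * Real.exp (-L) := by
  obtain ⟨i1, e1⟩ := M.integral_exp_sampling t i 1
  obtain ⟨i2, e2⟩ := M.integral_exp_sampling t i (-1)
  have hint := (i1.add i2).const_mul (Real.exp (-L))
  have hle : ∀ ω, max 0 (|(q ω).draw ω t i - (q ω).mean i| - L * Real.sqrt ((q ω).var i)) ≤
      Real.exp (-L) * (Real.exp (1 * ω (.sampling t i)) + Real.exp (-1 * ω (.sampling t i))) := by
    intro ω
    set z := ω (.sampling t i)
    have hs0 := Real.sqrt_nonneg ((q ω).var i)
    have hs1 : Real.sqrt ((q ω).var i) ≤ 1 := Real.sqrt_le_one.2 (by exact_mod_cast hq ω i)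
    refine max_le (by positivity) ?_
    have h1 : (q ω).draw ω t i - (q ω).mean i = Real.sqrt ((q ω).var i) * z := by
      simp only [Params.draw]; ring
    rw [h1, abs_mul, abs_of_nonneg hs0]
    -- From x ≤ exp x and exp |z| ≤ exp z + exp (-z). Each exponential has mean exp(1/2) ≤ 2, whence
    -- the constant 4.
    have h2 : |z| - L ≤ Real.exp (-L) * (Real.exp (1 * z) + Real.exp (-1 * z)) := by
      have h3 : |z| - L ≤ Real.exp (-L + |z|) := by
        linarith [Real.add_one_le_exp (-L + |z|)]
      rw [Real.exp_add] at h3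
      refine h3.trans (mul_le_mul_of_nonneg_left ?_ (Real.exp_pos _).le)
      rcases abs_cases z with ⟨hz, _⟩ | ⟨hz, _⟩ <;> rw [hz]
      · rw [one_mul]; linarith [Real.exp_pos (-1 * z)]
      · rw [neg_one_mul]; linarith [Real.exp_pos (1 * z)]
    have h4 : 0 ≤ Real.exp (-L) * (Real.exp (1 * z) + Real.exp (-1 * z)) := by positivity
    rcases le_total (|z| - L) 0 with h5 | h5
    · nlinarith
    · nlinarith
  have hqm := h.measurable
  have hmeas : Measurable fun ω => max 0 (|(q ω).draw ω t i - (q ω).mean i| -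
      L * Real.sqrt ((q ω).var i)) := by
    have h1 := (measurable_params_mean i).comp hqm
    have h2 := Real.continuous_sqrt.measurable.comp
      ((measurable_params_var i).comp hqm).coe_nnreal_real
    have h3 : Measurable fun ω => (q ω).draw ω t i :=
      h1.add (h2.mul (measurable_pi_apply _))
    exact measurable_const.max ((h3.sub h1).abs.sub (h2.const_mul L))
  have hI := hint.mono' hmeas.aestronglyMeasurable (Filter.Eventually.of_forall fun ω => by
    rw [Real.norm_of_nonneg (le_max_left _ _)]; exact hle ω)
  refine ⟨hI, (integral_mono hI hint hle).trans ?_⟩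
  simp only [Pi.add_apply]
  rw [integral_const_mul, integral_add i1 i2, e1, e2]
  have h6 : Real.exp (1 / 2) ≤ 2 := by
    have h7 : Real.exp (1 / 2) ^ 2 = Real.exp 1 := by
      rw [← Real.exp_nat_mul]; norm_num
    nlinarith [Real.exp_one_lt_d9, Real.exp_pos (1 / 2)]
  norm_num at h6 ⊢
  nlinarith [Real.exp_pos (-L)]

end Excess

/-! ### Regret of one step -/

section Step

variable [Fintype ι] {M : SemiBandit ι} (O : MinOracle M.feasible)

theorem SemiBandit.integrable_meanReward {θ : (Source ι → ℝ) → ι → ℝ}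
    {a : (Source ι → ℝ) → Finset ι} (hθ : Measurable θ) (ha : Measurable a)
    (hi : ∀ i, Integrable (fun ω => θ ω i) M.law) :
    Integrable (fun ω => M.meanReward (θ ω) (a ω)) M.law := by
  refine Integrable.mono' (g := fun ω => ∑ i, (|θ ω i| + M.cost 0 i)) ?_
    (M.measurable_meanReward hθ ha).aestronglyMeasurable
    (Filter.Eventually.of_forall fun ω => M.abs_meanReward_le _ _)
  exact integrable_finsetSum _ fun i _ => (hi i).abs.add (integrable_const _)

theorem SemiBandit.Tracks.step_regret_le [DecidableEq ι] {n t : ℕ} {q : (Source ι → ℝ) → Params ι}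
    (h : M.Tracks n (fun _ => ()) q) (hnt : n ≤ t) (hq : ∀ ω i, (q ω).var i ≤ 1)
    (L : ℝ) (hL : 0 ≤ L) :
    Integrable (fun ω => M.feasible.sup' M.feasible_nonempty (M.meanReward (thetaStar ω))
      - M.meanReward (thetaStar ω) (M.select O (q ω) ω t)) M.law ∧
    Integrable (fun ω => ∑ i, if i ∈ M.select O (q ω) ω t then
      2 * L * Real.sqrt ((q ω).var i) else 0) M.law ∧
    ∫ ω, (M.feasible.sup' M.feasible_nonempty (M.meanReward (thetaStar ω))
      - M.meanReward (thetaStar ω) (M.select O (q ω) ω t)) ∂M.law ≤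
    (∫ ω, ∑ i, (if i ∈ M.select O (q ω) ω t then 2 * L * Real.sqrt ((q ω).var i) else 0) ∂M.law) +
      8 * Fintype.card ι * Real.exp (-L) := by
  have hqm := h.measurable
  have hid := h.identDistrib hnt
  have hdm : Measurable fun ω => (q ω).draw ω t := by
    simp only [Params.draw_eq_affine]; fun_prop
  have hsm : Measurable fun ω => M.select O (q ω) ω t := by
    simp only [SemiBandit.select]; fun_prop
  have hdi : ∀ i, Integrable (fun ω => (q ω).draw ω t i) M.law := by
    intro i
    have hu : Measurable fun x : (ι → ℝ) × Params ι => x.1 i := by fun_prop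
    exact (hid.comp hu).integrable_iff.1 (M.integrable_thetaStar i)
  -- the values of the optimal super-arms for the true means and for the draw
  set g : (ι → ℝ) → ℝ := fun θ => M.meanReward θ (O.solve (M.cost θ)) with hg
  have hgm : Measurable g := M.measurable_meanReward measurable_id
    (O.measurable_solve.comp M.measurable_cost)
  have hg1 : Integrable (fun ω => g (thetaStar ω)) M.law :=
    SemiBandit.integrable_meanReward (by fun_prop) (by fun_prop) M.integrable_thetaStar
  have hg2 : Integrable (fun ω => g ((q ω).draw ω t)) M.law :=
    SemiBandit.integrable_meanReward hdm hsm hdi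
  -- Probability matching: the unknown optimal value is exchanged for the value at the draw,
  -- attained by the played super-arm.
  have hg3 : ∫ ω, g (thetaStar ω) ∂M.law = ∫ ω, g ((q ω).draw ω t) ∂M.law :=
    (hid.comp (hgm.comp measurable_fst)).integral_eq
  have hr : Integrable (fun ω => M.meanReward (thetaStar ω) (M.select O (q ω) ω t)) M.law :=
    SemiBandit.integrable_meanReward (by fun_prop) hsm M.integrable_thetaStar
  have hvm : ∀ i, Measurable fun ω => Real.sqrt ((q ω).var i) := fun i =>
    Real.continuous_sqrt.measurable.comp ((measurable_params_var i).comp hqm).coe_nnreal_real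
  have hw : ∀ i, Integrable (fun ω => if i ∈ M.select O (q ω) ω t then
      2 * L * Real.sqrt ((q ω).var i) else 0) M.law := by
    intro i
    refine Integrable.mono' (integrable_const (2 * L)) (Measurable.ite (measurableSet_mem hsm i)
      ((hvm i).const_mul _) measurable_const).aestronglyMeasurable
      (Filter.Eventually.of_forall fun ω => ?_)
    have hs0 := Real.sqrt_nonneg ((q ω).var i)
    have hs1 : Real.sqrt ((q ω).var i) ≤ 1 := Real.sqrt_le_one.2 (by exact_mod_cast hq ω i)
    split_ifs
    · rw [Real.norm_of_nonneg (by positivity)]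
      nlinarith
    · simpa using hL
  have hW := integrable_finsetSum (Finset.univ : Finset ι) fun i _ => hw i
  -- the deviations from the beliefs
  have hx := fun i => h.integral_excess_le t hq i L
  have hy : ∀ i, Integrable (fun ω => max 0 (|thetaStar ω i - (q ω).mean i| -
        L * Real.sqrt ((q ω).var i))) M.law ∧
      ∫ ω, max 0 (|thetaStar ω i - (q ω).mean i| - L * Real.sqrt ((q ω).var i)) ∂M.law ≤
        4 * Real.exp (-L) := by
    intro i
    have hu : Measurable fun x : (ι → ℝ) × Params ι =>
        max 0 (|x.1 i - x.2.mean i| - L * Real.sqrt (x.2.var i)) := by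
      fun_prop
    have h1 := hid.comp hu
    exact ⟨h1.integrable_iff.2 (hx i).1, h1.integral_eq.trans_le (hx i).2⟩
  have hsum : ∀ i, Integrable (fun ω =>
      (if i ∈ M.select O (q ω) ω t then 2 * L * Real.sqrt ((q ω).var i) else 0) +
        (max 0 (|thetaStar ω i - (q ω).mean i| - L * Real.sqrt ((q ω).var i)) +
          max 0 (|(q ω).draw ω t i - (q ω).mean i| - L * Real.sqrt ((q ω).var i)))) M.law :=
    fun i => (hw i).add ((hy i).1.add (hx i).1)
  simp only [M.sup'_meanReward O]
  refine ⟨hg1.sub hr, hW, ?_⟩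
  have hD : Integrable (fun ω => g ((q ω).draw ω t) -
      M.meanReward (thetaStar ω) (M.select O (q ω) ω t)) M.law := hg2.sub hr
  calc ∫ ω, (g (thetaStar ω) - M.meanReward (thetaStar ω) (M.select O (q ω) ω t)) ∂M.law
      = ∫ ω, (g ((q ω).draw ω t) -
          M.meanReward (thetaStar ω) (M.select O (q ω) ω t)) ∂M.law := by
        rw [integral_sub hg1 hr, integral_sub hg2 hr, hg3]
    _ ≤ ∫ ω, ∑ i, ((if i ∈ M.select O (q ω) ω t then 2 * L * Real.sqrt ((q ω).var i) else 0) +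
        (max 0 (|thetaStar ω i - (q ω).mean i| - L * Real.sqrt ((q ω).var i)) +
          max 0 (|(q ω).draw ω t i - (q ω).mean i| - L * Real.sqrt ((q ω).var i)))) ∂M.law := by
        refine integral_mono hD ?_ fun ω => ?_
        · exact integrable_finsetSum _ fun i _ => hsum i
        · exact M.meanReward_sub_le ((q ω).draw ω t) (thetaStar ω) (q ω).mean
            (fun i => Real.sqrt ((q ω).var i)) L (M.select O (q ω) ω t)
    _ = (∫ ω, ∑ i, (if i ∈ M.select O (q ω) ω t then 2 * L * Real.sqrt ((q ω).var i) else 0)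
          ∂M.law) + ∑ i,
        (∫ ω, max 0 (|thetaStar ω i - (q ω).mean i| - L * Real.sqrt ((q ω).var i)) ∂M.law +
          ∫ ω, max 0 (|(q ω).draw ω t i - (q ω).mean i| - L * Real.sqrt ((q ω).var i))
            ∂M.law) := by
        rw [integral_finsetSum _ fun i _ => hw i, ← Finset.sum_add_distrib,
          integral_finsetSum _ fun i _ => hsum i]
        refine Finset.sum_congr rfl fun i _ => ?_
        rw [← integral_add (hy i).1 (hx i).1]
        exact integral_add (hw i) ((hy i).1.add (hx i).1)
    _ ≤ _ := by
        refine add_le_add le_rfl ?_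
        refine (Finset.sum_le_card_nsmul _ _ (8 * Real.exp (-L)) fun i _ => ?_).trans ?_
        · linarith [(hx i).2, (hy i).2]
        · rw [nsmul_eq_mul, Finset.card_univ]
          exact le_of_eq (by ring)

end Step

/-! ### Summation over all steps -/

section Total

variable [Fintype ι] [DecidableEq ι] (M : SemiBandit ι) (O : MinOracle M.feasible)

theorem SemiBandit.var_posterior_le_one (hM : ∀ i, M.noiseVar i ≤ 1) (K : ℕ) (ω : Source ι → ℝ)
    (b : ℕ) (i : ι) : (M.posterior O K ω b).var i ≤ 1 := by
  have h := le_of_add_le_left (M.inv_var_posterior_ge O hM K ω b i)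
  have hpos := (M.tracks_posterior O K b).var_pos ω i
  exact (one_le_inv₀ hpos).1 h

/-- Beliefs are constant within a batch, so exchanging the sums leaves one pigeonhole sum per arm,
for every outcome. -/
theorem SemiBandit.sum_width_le (hM : ∀ i, M.noiseVar i ≤ 1) (K B : ℕ) {L : ℝ} (hL : 0 ≤ L)
    (ω : Source ι → ℝ) :
    ∑ b ∈ Finset.range B, ∑ j ∈ Finset.range K, ∑ i,
      (if i ∈ M.select O (M.posterior O K ω b) ω (b * K + j + 1) then
        2 * L * Real.sqrt ((M.posterior O K ω b).var i) else 0) ≤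
    Fintype.card ι * (2 * L *
      (3 * Real.sqrt (1 + (B * K : ℕ)) + 2 * K * Real.log (1 + (B * K : ℕ)))) := by
  have h1 : ∀ b, ∑ j ∈ Finset.range K, ∑ i,
      (if i ∈ M.select O (M.posterior O K ω b) ω (b * K + j + 1) then
        2 * L * Real.sqrt ((M.posterior O K ω b).var i) else 0) =
      ∑ i, 2 * L * (M.plays O K ω i b * Real.sqrt ((M.posterior O K ω b).var i)) := by
    intro b
    rw [Finset.sum_comm]
    refine Finset.sum_congr rfl fun i _ => ?_
    rw [SemiBandit.plays, Nat.cast_sum, Finset.sum_mul, Finset.mul_sum]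
    refine Finset.sum_congr rfl fun j hj => ?_
    rw [M.superArm_eq O (Finset.mem_range.1 hj)]
    split_ifs <;> simp
  simp only [h1]
  rw [Finset.sum_comm]
  refine (Finset.sum_le_card_nsmul _ _ _ fun i _ => ?_).trans_eq
    (by rw [nsmul_eq_mul, Finset.card_univ])
  rw [← Finset.mul_sum]
  refine mul_le_mul_of_nonneg_left ?_ (by positivity)
  refine le_trans (Finset.sum_le_sum fun b _ => ?_) (sum_div_sqrt_le (M.plays_le O K ω i) B)
  exact mul_le_mul_of_nonneg_left (M.sqrt_var_posterior_le O hM K ω b i) (by positivity)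

theorem SemiBandit.bayesRegret_le (hM : ∀ i, M.noiseVar i ≤ 1) (K B : ℕ) {L : ℝ} (hL : 0 ≤ L) :
    Integrable (M.regret O K (B * K)) M.law ∧
    M.bayesRegret O K (B * K) ≤ Fintype.card ι * (2 * L *
      (3 * Real.sqrt (1 + (B * K : ℕ)) + 2 * K * Real.log (1 + (B * K : ℕ)))) +
      (B * K : ℕ) * (8 * Fintype.card ι * Real.exp (-L)) := by
  have hstep := fun b j => (M.tracks_posterior O K b).step_regret_le O
    (show b * K + 1 ≤ b * K + j + 1 by omega)
    (fun ω i => M.var_posterior_le_one O hM K ω b i) L hL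
  have hreg : M.regret O K (B * K) = fun ω => ∑ b ∈ Finset.range B, ∑ j ∈ Finset.range K,
      (M.feasible.sup' M.feasible_nonempty (M.meanReward (thetaStar ω)) -
        M.meanReward (thetaStar ω) (M.select O (M.posterior O K ω b) ω (b * K + j + 1))) := by
    funext ω
    rw [SemiBandit.regret, sum_Icc_mul_eq]
    refine Finset.sum_congr rfl fun b _ => Finset.sum_congr rfl fun j hj => ?_
    rw [M.superArm_eq O (Finset.mem_range.1 hj)]
  have hint : ∀ b, Integrable (fun ω => ∑ j ∈ Finset.range K,
      (M.feasible.sup' M.feasible_nonempty (M.meanReward (thetaStar ω)) -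
        M.meanReward (thetaStar ω) (M.select O (M.posterior O K ω b) ω (b * K + j + 1)))) M.law :=
    fun b => integrable_finsetSum _ fun j _ => (hstep b j).1
  have hint' : ∀ b, Integrable (fun ω => ∑ j ∈ Finset.range K, ∑ i,
      (if i ∈ M.select O (M.posterior O K ω b) ω (b * K + j + 1) then
        2 * L * Real.sqrt ((M.posterior O K ω b).var i) else 0)) M.law :=
    fun b => integrable_finsetSum _ fun j _ => (hstep b j).2.1
  rw [SemiBandit.bayesRegret, hreg]
  refine ⟨integrable_finsetSum _ fun b _ => hint b, ?_⟩
  rw [integral_finsetSum _ fun b _ => hint b]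
  have h1 : ∀ b ∈ Finset.range B, ∫ ω, ∑ j ∈ Finset.range K,
      (M.feasible.sup' M.feasible_nonempty (M.meanReward (thetaStar ω)) -
        M.meanReward (thetaStar ω) (M.select O (M.posterior O K ω b) ω (b * K + j + 1))) ∂M.law ≤
      ∫ ω, ∑ j ∈ Finset.range K, ∑ i,
      (if i ∈ M.select O (M.posterior O K ω b) ω (b * K + j + 1) then
        2 * L * Real.sqrt ((M.posterior O K ω b).var i) else 0) ∂M.law +
      K * (8 * Fintype.card ι * Real.exp (-L)) := by
    intro b _
    rw [integral_finsetSum _ fun j _ => (hstep b j).1,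
      integral_finsetSum _ fun j _ => (hstep b j).2.1]
    refine (Finset.sum_le_sum fun j _ => (hstep b j).2.2).trans_eq ?_
    rw [Finset.sum_add_distrib, Finset.sum_const, Finset.card_range, nsmul_eq_mul]
  refine (Finset.sum_le_sum h1).trans ?_
  rw [Finset.sum_add_distrib, Finset.sum_const, Finset.card_range, nsmul_eq_mul,
    ← integral_finsetSum _ fun b _ => hint' b, ← mul_assoc, ← Nat.cast_mul]
  refine add_le_add ?_ le_rfl
  refine (integral_mono (integrable_finsetSum _ fun b _ => hint' b) (integrable_const _)
    fun ω => M.sum_width_le O hM K B hL ω).trans_eq ?_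
  simp

end Total

end BatchedTS

/-! ### Choice of L and of the constants -/

theorem mainTheorem3 :
    ∃ (C : ℝ) (k : ℕ), ∀ (ι : Type*) [Fintype ι] [DecidableEq ι] (M : BatchedTS.SemiBandit ι)
      (O : BatchedTS.MinOracle M.feasible) (K B T : ℕ),
      0 < K → 0 < B → T = B * K → Fintype.card ι ≤ T → (∀ i, M.noiseVar i ≤ 1) →
      Integrable (M.regret O K T) M.law ∧
      M.bayesRegret O K T ≤
        C * (1 + Real.log T) ^ k *
          ((Fintype.card ι : ℝ) * K + (Fintype.card ι : ℝ) * Real.sqrt T) := by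
  -- One logarithm comes from L, the other from the K log(1 + T) term. The constant is 12 (from √T)
  -- plus 8 (from the excesses, using √T ≥ 1).
  refine ⟨20, 2, fun ι _ _ M O K B T hK hB hT _ hM => ?_⟩
  subst hT
  have hT1 : (1 : ℝ) ≤ (B * K : ℕ) := by exact_mod_cast Nat.mul_pos hB hK
  have hL : 0 ≤ Real.log (B * K : ℕ) := Real.log_nonneg hT1
  -- Here L = log T, so exp(-L) = 1/T cancels the number of steps.
  obtain ⟨h1, h2⟩ := M.bayesRegret_le O hM K B hL
  refine ⟨h1, h2.trans ?_⟩
  rw [Real.exp_neg, Real.exp_log (by linarith)]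
  set T : ℝ := ((B * K : ℕ) : ℝ)
  set n : ℝ := (Fintype.card ι : ℝ)
  set l : ℝ := Real.log T
  have hn : 0 ≤ n := Nat.cast_nonneg _
  have hK0 : (0 : ℝ) ≤ K := Nat.cast_nonneg _
  have hs1 : 1 ≤ Real.sqrt T := Real.one_le_sqrt.2 hT1
  have hs : Real.sqrt (1 + T) ≤ 2 * Real.sqrt T := by
    refine Real.sqrt_le_iff.2 ⟨by positivity, ?_⟩
    rw [mul_pow, Real.sq_sqrt (by linarith)]
    linarith
  have hl : Real.log (1 + T) ≤ 1 + l := by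
    have h3 : Real.log (1 + T) ≤ Real.log (2 * T) :=
      Real.log_le_log (by linarith) (by linarith)
    rw [Real.log_mul (by norm_num) (by linarith)] at h3
    linarith [Real.log_two_lt_d9]
  have e1 : T * (8 * n * T⁻¹) = 8 * n := by
    field_simp
  rw [e1]
  have h4 : 2 * l * (3 * Real.sqrt (1 + T) + 2 * K * Real.log (1 + T)) ≤
      2 * (1 + l) * (6 * Real.sqrt T + 2 * K * (1 + l)) := by
    have h5 : 2 * K * Real.log (1 + T) ≤ 2 * K * (1 + l) := by gcongr
    have h6 : 0 ≤ Real.log (1 + T) := Real.log_nonneg (by linarith)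
    refine mul_le_mul ?_ ?_ ?_ ?_
    · linarith
    · linarith
    · positivity
    · positivity
  have h5 : 2 * (1 + l) * (6 * Real.sqrt T + 2 * K * (1 + l)) + 8 ≤
      20 * (1 + l) ^ 2 * (K + Real.sqrt T) := by
    nlinarith [mul_nonneg hL (by linarith : 0 ≤ Real.sqrt T), mul_nonneg hL hK0,
      mul_nonneg (mul_nonneg hL hL) (by linarith : 0 ≤ Real.sqrt T),
      mul_nonneg (mul_nonneg hL hL) hK0]
  nlinarith [mul_le_mul_of_nonneg_left h4 hn, mul_le_mul_of_nonneg_left h5 hn]
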